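/- Let $M$ be a smooth finite-dimensional manifold without boundary, and let $\alpha$ be a contact form on $M$: a smooth nowhere vanishing $1$-form such that $d\alpha$ is nondegenerate on the hyperplane field $\xi=\ker\alpha$ (so that $\dim M$ is odd). Let $\theta$ be the coordinate of $\mathbb{R}$ and let $\omega=d(e^{\theta}\alpha)$ on $M\times\mathbb{R}$, where $\alpha$ is pulled back from $M$. An (embedded, boundaryless) submanifold $Y\subset M$ is called contact coisotropic if for every $p\in Y$ $$\{v\in\xi_p : d\alpha(v,w)=0 \text{ for all } w\in T_pY\cap\xi_p\}\subset T_pY\cap\xi_p ,$$ and a submanifold $Z\subset M\times\mathbb{R}$ is called symplectic coisotropic if for every $q\in Z$ $$\{v\in T_q(M\times\mathbb{R}) : \omega(v,w)=0 \text{ for all } w\in T_qZ\}\subset T_qZ .$$ Then $\omega$ is a symplectic form on $M\times\mathbb{R}$ (so that $(M\times\mathbb{R},\omega)$ is a symplectic manifold, the symplectization of $(M,\ker\alpha)$), and: (i) if $Y$ is a contact coisotropic submanifold of $(M,\ker\alpha)$, then $Y\times\mathbb{R}$ is a symplectic coisotropic submanifold of $(M\times\mathbb{R},\omega)$; (ii)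 if $Y$ is a submanifold of $M$ and $Y\times\mathbb{R}$ is a symplectic coisotropic submanifold of $(M\times\mathbb{R},\omega)$, then $Y$ is a contact coisotropic submanifold of $(M,\ker\alpha)$. -/

import Mathlib

open scoped Manifold ContDiff Topology

noncomputable section

namespace CoisotropicCorrespondence

section Forms

variable {E : Type*} [NormedAddCommGroup E] [NormedSpace ℝ E]
  {H : Type*} [TopologicalSpace H] (I : ModelWithCorners ℝ E H)
  {M : Type*} [TopologicalSpace M] [ChartedSpace H M]

/-- A (not necessarily continuous) differential `k`-form on the manifold `M`. -/
abbrev DiffForm (M : Type*) [TopologicalSpace M] [ChartedSpace H M] (k : ℕ) : Type _ :=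
  ∀ x : M, TangentSpace I x [⋀^Fin k]→L[ℝ] ℝ

variable {I}

/-- The expression of `η` in the preferred chart `φ` around `x₀`: the pullback of `η` under
`φ⁻¹`, a form on the model vector space which is meaningful on the target of `φ`. -/
def DiffForm.inChart {k : ℕ} (η : DiffForm I M k) (x₀ : M) : E → E [⋀^Fin k]→L[ℝ] ℝ :=
  fun y ↦ (η ((extChartAt I x₀).symm y)).compContinuousLinearMap
    (mfderiv 𝓘(ℝ, E) I (extChartAt I x₀).symm y)

/-- The form `η` on a manifold without boundary is smooth: its expressions in all the preferred
charts (which form an atlas) are smooth. -/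
def DiffForm.IsSmooth {k : ℕ} (η : DiffForm I M k) : Prop :=
  ∀ x₀ : M, ContDiffOn ℝ ∞ (η.inChart x₀) (extChartAt I x₀).target

/-- The exterior derivative of a form on a manifold without boundary: at `x`, take the exterior
derivative in the preferred chart around `x` and transport it back to the manifold. -/
def DiffForm.d {k : ℕ} (η : DiffForm I M k) : DiffForm I M (k + 1) :=
  fun x ↦ (extDeriv (η.inChart x) (extChartAt I x x)).compContinuousLinearMap
    (mfderiv I 𝓘(ℝ, E) (extChartAt I x) x)

/-- `Ω` is a symplectic form on a manifold without boundary: a smooth, closed, nondegenerate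
`2`-form. -/
structure IsSymplecticForm (Ω : DiffForm I M 2) : Prop where
  smooth : Ω.IsSmooth
  closed : ∀ x : M, Ω.d x = 0
  nondegenerate : ∀ (x : M) (v : TangentSpace I x),
    (∀ w : TangentSpace I x, Ω x ![v, w] = 0) → v = 0

/-- The field `ξ = ker α` of kernels of a `1`-form. -/
def ker (α : DiffForm I M 1) (x : M) : Submodule ℝ (TangentSpace I x) where
  carrier := {v | α x ![v] = 0}
  add_mem' {v w} hv hw := by
    have h := (α x).map_update_add ![v] 0 v w
    have e (u : TangentSpace I x) : Function.update ![v] 0 u = ![u] := by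
      ext i; fin_cases i; rfl
    rw [e, e, e] at h
    exact h.trans (by rw [show α x ![v] = 0 from hv, show α x ![w] = 0 from hw, add_zero])
  zero_mem' := (α x).map_coord_zero (m := ![0]) 0 rfl
  smul_mem' c v hv := by
    have h := (α x).map_update_smul ![v] 0 c v
    have e (u : TangentSpace I x) : Function.update ![v] 0 u = ![u] := by
      ext i; fin_cases i; rfl
    rw [e, e] at h
    exact h.trans (by rw [show α x ![v] = 0 from hv, smul_zero])

/-- `α` is a contact form on a manifold without boundary: it is smooth, `ξ = ker α` is a field of
hyperplanes (that is, `α` has no zeros), and `dα` restricts to a nondegenerate form on `ξ`. -/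
structure IsContactForm (α : DiffForm I M 1) : Prop where
  smooth : α.IsSmooth
  ne_zero : ∀ x : M, α x ≠ 0
  nondegenerate : ∀ x : M, ∀ v ∈ ker α x, (∀ w ∈ ker α x, α.d x ![v, w] = 0) → v = 0

end Forms

section Submanifolds

variable {E : Type*} [NormedAddCommGroup E] [NormedSpace ℝ E]
  {H : Type*} [TopologicalSpace H] (I : ModelWithCorners ℝ E H)
  {M : Type*} [TopologicalSpace M] [ChartedSpace H M]

/-- `Y` is an (embedded, smooth, boundaryless) submanifold of the finite-dimensional manifold
without boundary `M`, of some dimension `k`: around each of its points there is a chart of `M`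
that maps `Y` to a linear subspace of dimension `k`. -/
def IsSubmanifold (Y : Set M) : Prop :=
  ∃ k : ℕ, ∀ p ∈ Y, ∃ e ∈ IsManifold.maximalAtlas I ∞ M, p ∈ e.source ∧
    ∃ V : Submodule ℝ E, Module.finrank ℝ V = k ∧
      ∀ q ∈ e.source, q ∈ Y ↔ e.extend I q ∈ V

/-- The tangent space `T_p Y ⊆ T_p M`: the velocities at time `0` of the smooth curves in `M`
that run in `Y` and pass through `p` at time `0`. For a submanifold `Y` these velocities already
form a linear subspace; the span only packages them as a `Submodule`. -/
def tangentSpaceOf (Y : Set M) (p : M) : Submodule ℝ (TangentSpace I p) :=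
  Submodule.span ℝ {v | ∃ γ : ℝ → M, ContMDiffAt 𝓘(ℝ, ℝ) I ∞ γ 0 ∧ (∀ᶠ t in 𝓝 0, γ t ∈ Y) ∧
    tangentMap 𝓘(ℝ, ℝ) I γ ⟨0, (1 : ℝ)⟩ = ⟨p, v⟩}

variable {I}

/-- `Y` is a contact coisotropic submanifold of `(M, ker α)`: it is a submanifold, and at every
`p ∈ Y` the orthogonal complement of `T_p Y ∩ ξ_p` in `ξ_p`, with respect to `dα` restricted to
`ξ_p`, is contained in `T_p Y ∩ ξ_p`. -/
def IsContactCoisotropic (α : DiffForm I M 1) (Y : Set M) : Prop :=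
  IsSubmanifold I Y ∧ ∀ p ∈ Y, ∀ v ∈ ker α p,
    (∀ w ∈ tangentSpaceOf I Y p ⊓ ker α p, α.d p ![v, w] = 0) →
      v ∈ tangentSpaceOf I Y p ⊓ ker α p

/-- `Y` is a (symplectic) coisotropic submanifold of the symplectic manifold `(M, Ω)`: it is a
submanifold, and at every `p ∈ Y` the `Ω`-orthogonal complement of `T_p Y` in `T_p M` is contained
in `T_p Y`. -/
def IsSymplecticCoisotropic (Ω : DiffForm I M 2) (Y : Set M) : Prop :=
  IsSubmanifold I Y ∧ ∀ p ∈ Y, ∀ v : TangentSpace I p,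
    (∀ w ∈ tangentSpaceOf I Y p, Ω p ![v, w] = 0) → v ∈ tangentSpaceOf I Y p

/-- The `1`-form `e^θ α` on `M × ℝ`, where `θ` is the coordinate of `ℝ` and `α` stands for its
pullback under the projection `M × ℝ → M`. -/
def expMulForm (α : DiffForm I M 1) : DiffForm (I.prod 𝓘(ℝ, ℝ)) (M × ℝ) 1 :=
  fun q ↦ Real.exp q.2 •
    (α q.1).compContinuousLinearMap (mfderiv (I.prod 𝓘(ℝ, ℝ)) I Prod.fst q)

/-- The form `d(e^θ α)` on the symplectization `M × ℝ`. -/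
def symplectizationForm (α : DiffForm I M 1) : DiffForm (I.prod 𝓘(ℝ, ℝ)) (M × ℝ) 2 :=
  (expMulForm α).d

end Submanifolds

end CoisotropicCorrespondence

end

namespace CoisotropicCorrespondence

/-! Everything reduces to linear algebra at a point. Expanding, `ω(v, w) = e^θ (v₂ α(w₁) - w₂ α(v₁)
+ dα(v₁, w₁))` (`symplectizationForm_apply`), and `T(Y × ℝ) = TY × ℝ`
(`mem_tangentSpaceOf_cylinder`). If `v` is `ω`-orthogonal to `T × ℝ`, pairing with the `ℝ`-direction
gives `α(v₁) = 0`, and then `dα(v₁, ·) = -v₂ α` on `T`, which vanishes on `T ∩ ξ`. Taking `T = TM`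
gives nondegeneracy; taking `T = TY` gives (i). For (ii), if `v ∈ ξ` is `dα`-orthogonal to `TY ∩ ξ`,
then `dα(v, ·)` vanishes on the kernel of `α` in `TY`, so it equals `c α` there
(`exists_eq_mul_of_ker_le`); hence `(v, -c)` is `ω`-orthogonal to `T(Y × ℝ)`. Smoothness and
closedness of `ω` rest on the chart independence of `d` (`DiffForm.IsSmooth.inChart_d`). -/

theorem two_le_infty : minSmoothness ℝ 2 ≤ (∞ : WithTop ℕ∞) := by
  simpa using WithTop.coe_le_coe.2 (le_top : (2 : ℕ∞) ≤ ⊤)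

/-! ### Chart independence of the exterior derivative -/

section Naturality

variable {E : Type*} [NormedAddCommGroup E] [NormedSpace ℝ E]
  {H : Type*} [TopologicalSpace H] {I : ModelWithCorners ℝ E H} [I.Boundaryless]
  {M : Type*} [TopologicalSpace M] [ChartedSpace H M] [IsManifold I ∞ M]

theorem mdifferentiableAt_extChartAt_symm {x₀ : M} {y : E} (hy : y ∈ (extChartAt I x₀).target) :
    MDifferentiableAt 𝓘(ℝ, E) I (extChartAt I x₀).symm y :=
  (((contMDiffOn_extChartAt_symm (n := ∞) x₀) y hy).contMDiffAt
    ((isOpen_extChartAt_target x₀).mem_nhds hy)).mdifferentiableAt (by simp)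

/-- The expressions of a form in two charts are related by pullback under the transition map. -/
theorem DiffForm.inChart_eq_pullback {k : ℕ} (η : DiffForm I M k) (x₀ x₁ : M) {z : E}
    (hz : z ∈ (extChartAt I x₀).target) (hz' : (extChartAt I x₀).symm z ∈ (extChartAt I x₁).source) :
    η.inChart x₀ z =
      (η.inChart x₁ (extChartAt I x₁ ((extChartAt I x₀).symm z))).compContinuousLinearMap
        (fderiv ℝ (extChartAt I x₁ ∘ (extChartAt I x₀).symm) z) := by
  have h₀ := mdifferentiableAt_extChartAt_symm (I := I) hz
  have h₁ := mdifferentiableAt_extChartAt_symm (I := I) ((extChartAt I x₁).map_source hz')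
  have h₂ : MDifferentiableAt I 𝓘(ℝ, E) (extChartAt I x₁) ((extChartAt I x₀).symm z) := by
    have : IsManifold I 1 M := IsManifold.of_le (n := ∞) (by simp)
    exact mdifferentiableAt_extChartAt (by simpa using hz')
  have hτ : MDifferentiableAt 𝓘(ℝ, E) 𝓘(ℝ, E)
      (extChartAt I x₁ ∘ (extChartAt I x₀).symm) z := h₂.comp z h₀
  have hev : (extChartAt I x₁).symm ∘ (extChartAt I x₁ ∘ (extChartAt I x₀).symm)
      =ᶠ[𝓝 z] (extChartAt I x₀).symm := by
    have : (extChartAt I x₀).symm ⁻¹' (extChartAt I x₁).source ∈ 𝓝 z :=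
      h₀.continuousAt ((isOpen_extChartAt_source x₁).mem_nhds hz')
    filter_upwards [this] with w hw
    exact (extChartAt I x₁).left_inv hw
  have hchain := mfderiv_comp z (I := 𝓘(ℝ, E)) (I' := 𝓘(ℝ, E)) (I'' := I) h₁ hτ
  rw [hev.mfderiv_eq] at hchain
  have hpt : (extChartAt I x₁).symm (extChartAt I x₁ ((extChartAt I x₀).symm z)) =
    (extChartAt I x₀).symm z := (extChartAt I x₁).left_inv hz'
  -- The values of `η` have types depending on the base point; all of them unfold to forms on `E`,
  -- where they can be compared.
  have hη : ∀ p q : M, p = q → (η p : E [⋀^Fin k]→L[ℝ] ℝ) = η q := by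
    rintro p _ rfl; rfl
  rw [mfderiv_eq_fderiv] at hchain
  unfold DiffForm.inChart
  rw [hchain]
  ext v
  have key := DFunLike.congr_fun (F := E [⋀^Fin k]→L[ℝ] ℝ) (hη _ _ hpt.symm)
  exact key _

/-- The exterior derivative of a smooth form may be computed in any of the preferred charts. -/
theorem DiffForm.IsSmooth.inChart_d {k : ℕ} {η : DiffForm I M k} (hη : η.IsSmooth) (x₀ : M) {y : E}
    (hy : y ∈ (extChartAt I x₀).target) :
    η.d.inChart x₀ y = extDeriv (η.inChart x₀) y := by
  set x := (extChartAt I x₀).symm y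
  have h₀ := mdifferentiableAt_extChartAt_symm (I := I) hy
  have hxs : x ∈ (extChartAt I x).source := mem_extChartAt_source x
  have hτ : ContDiffAt ℝ ∞ (extChartAt I x ∘ (extChartAt I x₀).symm) y := by
    rw [← contMDiffAt_iff_contDiffAt]
    exact ContMDiffAt.comp (I' := I) y (contMDiffAt_extChartAt (n := ∞) (x := x))
      (((contMDiffOn_extChartAt_symm (n := ∞) x₀) y hy).contMDiffAt
      ((isOpen_extChartAt_target x₀).mem_nhds hy))
  -- `η.d` at `x` is defined by the chart around `x`, so the expression in the chart around `x₀` is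
  -- pulled back from that one.
  have hev : η.inChart x₀ =ᶠ[𝓝 y] fun z ↦
      (η.inChart x ((extChartAt I x ∘ (extChartAt I x₀).symm) z)).compContinuousLinearMap
        (fderiv ℝ (extChartAt I x ∘ (extChartAt I x₀).symm) z) := by
    filter_upwards [(isOpen_extChartAt_target x₀).mem_nhds hy,
      h₀.continuousAt ((isOpen_extChartAt_source x).mem_nhds hxs)] with z hz hz'
    exact η.inChart_eq_pullback x₀ x hz hz'
  have hdiff : DifferentiableAt ℝ (η.inChart x) ((extChartAt I x ∘ (extChartAt I x₀).symm) y) :=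
    ((hη x).contDiffAt ((isOpen_extChartAt_target x).mem_nhds
      ((extChartAt I x).map_source hxs))).differentiableAt (by simp)
  rw [hev.extDeriv_eq, extDeriv_pullback hdiff hτ two_le_infty]
  have : IsManifold I 1 M := IsManifold.of_le (n := ∞) (by simp)
  have h₂ : MDifferentiableAt I 𝓘(ℝ, E) (extChartAt I x) x :=
    mdifferentiableAt_extChartAt (mem_chart_source H x)
  rw [← mfderiv_eq_fderiv, mfderiv_comp y (I' := I) h₂ h₀]
  rfl

omit [IsManifold I ∞ M] in
theorem DiffForm.IsSmooth.contDiffAt {k : ℕ} {η : DiffForm I M k} (hη : η.IsSmooth) (x₀ : M) {y : E}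
    (hy : y ∈ (extChartAt I x₀).target) : ContDiffAt ℝ ∞ (η.inChart x₀) y :=
  (hη x₀).contDiffAt ((isOpen_extChartAt_target x₀).mem_nhds hy)

theorem DiffForm.IsSmooth.d {k : ℕ} {η : DiffForm I M k} (hη : η.IsSmooth) : η.d.IsSmooth := by
  intro x₀
  have h : ContDiffOn ℝ ∞ (extDeriv (η.inChart x₀)) (extChartAt I x₀).target := fun y hy ↦
    (ContDiffAt.comp y
      (ContinuousAlternatingMap.alternatizeUncurryFinCLM ℝ E ℝ (n := k)).contDiff.contDiffAt
      ((hη.contDiffAt x₀ hy).fderiv_right (m := ∞) (by simp)) :).contDiffWithinAt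
  exact h.congr fun y hy ↦ hη.inChart_d x₀ hy

theorem DiffForm.IsSmooth.d_d {k : ℕ} {η : DiffForm I M k} (hη : η.IsSmooth) (x : M) :
    η.d.d x = 0 := by
  have hev : η.d.inChart x =ᶠ[𝓝 (extChartAt I x x)] extDeriv (η.inChart x) := by
    filter_upwards [extChartAt_target_mem_nhds (I := I) x] with y hy
    exact hη.inChart_d x hy
  rw [DiffForm.d, hev.extDeriv_eq, extDeriv_extDeriv_apply
    (hη.contDiffAt x (mem_extChartAt_target x)) two_le_infty]
  rfl

end Naturality


/-! ### The form `d(e^θ α)` in coordinates -/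

section Symplectization

variable {E : Type*} [NormedAddCommGroup E] [NormedSpace ℝ E]
  {H : Type*} [TopologicalSpace H] {I : ModelWithCorners ℝ E H} [I.Boundaryless]
  {M : Type*} [TopologicalSpace M] [ChartedSpace H M] [IsManifold I ∞ M]

/-- The tangent space at `x` is identified with `E` by the chart around `x` itself, so the inverse
chart has identity derivative there. -/
theorem DiffForm.inChart_apply_self {k : ℕ} (η : DiffForm I M k) (x : M) (v : Fin k → E) :
    η.inChart x (extChartAt I x x) v = η x v := by
  have : IsManifold I 1 M := IsManifold.of_le (n := ∞) (by simp)
  have hd := mfderivWithin_range_extChartAt_symm (I := I) (x := x)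
  rw [I.range_eq_univ, mfderivWithin_univ] at hd
  have hη : ∀ p q : M, p = q → (η p : E [⋀^Fin k]→L[ℝ] ℝ) = η q := by
    rintro p _ rfl; rfl
  have key := DFunLike.congr_fun (F := E [⋀^Fin k]→L[ℝ] ℝ)
    (hη _ _ ((extChartAt I x).left_inv (mem_extChartAt_source x)))
  unfold DiffForm.inChart
  rw [hd]
  exact key v

omit [I.Boundaryless] in
theorem DiffForm.d_apply {k : ℕ} (η : DiffForm I M k) (x : M) (v : Fin (k + 1) → E) :
    η.d x v = extDeriv (η.inChart x) (extChartAt I x x) v := by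
  have : IsManifold I 1 M := IsManifold.of_le (n := ∞) (by simp)
  unfold DiffForm.d
  rw [mfderiv_extChartAt_self]
  rfl

/-- The product chart is the identity on the `ℝ` factor and turns the projection to `M` into the
projection to `E`. -/
theorem expMulForm_inChart (α : DiffForm I M 1) (q : M × ℝ) {z : E × ℝ}
    (hz : z ∈ (extChartAt (I.prod 𝓘(ℝ, ℝ)) q).target) :
    (expMulForm α).inChart q z = Real.exp z.2 •
      (α.inChart q.1 z.1).compContinuousLinearMap (ContinuousLinearMap.fst ℝ E ℝ) := by
  have hz₁ : z.1 ∈ (extChartAt I q.1).target := by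
    rw [extChartAt_prod] at hz
    exact hz.1
  have h₀ := mdifferentiableAt_extChartAt_symm (I := I.prod 𝓘(ℝ, ℝ)) hz
  have h₁ := mdifferentiableAt_extChartAt_symm (I := I) hz₁
  have hcomp : Prod.fst ∘ (extChartAt (I.prod 𝓘(ℝ, ℝ)) q).symm =
      (extChartAt I q.1).symm ∘ (Prod.fst : E × ℝ → E) := by
    rw [extChartAt_prod]; rfl
  -- The chain rule on both sides of `hcomp`.
  have hd₁ := mfderiv_comp z (I := 𝓘(ℝ, E × ℝ)) (I' := I.prod 𝓘(ℝ, ℝ)) (I'' := I)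
    (g := Prod.fst) mdifferentiableAt_fst h₀
  have hd₂ := mfderiv_comp z (I := 𝓘(ℝ, E × ℝ)) (I' := 𝓘(ℝ, E)) (I'' := I)
    (f := (Prod.fst : E × ℝ → E)) h₁ differentiableAt_fst.mdifferentiableAt
  rw [hcomp, hd₂, mfderiv_eq_fderiv, fderiv_fst] at hd₁
  have hq : (extChartAt (I.prod 𝓘(ℝ, ℝ)) q).symm z = ((extChartAt I q.1).symm z.1, z.2) := by
    rw [extChartAt_prod]; rfl
  ext v
  have hα : ∀ p q : M, p = q → (α p : E [⋀^Fin 1]→L[ℝ] ℝ) = α q := by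
    rintro p _ rfl; rfl
  have key := DFunLike.congr_fun (F := E [⋀^Fin 1]→L[ℝ] ℝ) (hα _ _ (congrArg Prod.fst hq))
  have hv : ∀ i, (mfderiv (I.prod 𝓘(ℝ, ℝ)) I Prod.fst ((extChartAt (I.prod 𝓘(ℝ, ℝ)) q).symm z))
      ((mfderiv 𝓘(ℝ, E × ℝ) (I.prod 𝓘(ℝ, ℝ)) (extChartAt (I.prod 𝓘(ℝ, ℝ)) q).symm z) (v i)) =
      (mfderiv 𝓘(ℝ, E) I (extChartAt I q.1).symm z.1) (v i).1 := fun i ↦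
    (DFunLike.congr_fun (F := (E × ℝ) →L[ℝ] E) hd₁ (v i)).symm
  have h2 : ((extChartAt (I.prod 𝓘(ℝ, ℝ)) q).symm z).2 = z.2 := congrArg Prod.snd hq
  refine congrArg₂ (fun s t : ℝ ↦ Real.exp s * t) h2 ((key _).trans ?_)
  exact congrArg (α ((extChartAt I q.1).symm z.1) : E [⋀^Fin 1]→L[ℝ] ℝ) (funext hv)

theorem expMulForm_isSmooth {α : DiffForm I M 1} (hα : α.IsSmooth) :
    (expMulForm α).IsSmooth := by
  intro q
  refine ContDiffOn.congr ?_ fun z hz ↦ expMulForm_inChart α q hz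
  intro z hz
  have hz₁ : z.1 ∈ (extChartAt I q.1).target := by
    rw [extChartAt_prod] at hz
    exact hz.1
  refine ContDiffAt.contDiffWithinAt ?_
  refine (Real.contDiff_exp.comp contDiff_snd).contDiffAt.smul ?_
  exact ContDiffAt.comp z
    (g := fun f : E [⋀^Fin 1]→L[ℝ] ℝ ↦ f.compContinuousLinearMap (ContinuousLinearMap.fst ℝ E ℝ))
    (ContinuousAlternatingMap.compContinuousLinearMapCLM
      (ContinuousLinearMap.fst ℝ E ℝ) :
        (E [⋀^Fin 1]→L[ℝ] ℝ) →L[ℝ] ((E × ℝ) [⋀^Fin 1]→L[ℝ] ℝ)).contDiff.contDiffAt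
    (ContDiffAt.comp z (hα.contDiffAt q.1 hz₁) contDiff_fst.contDiffAt)

theorem extDeriv_one_form_apply {F : Type*} [NormedAddCommGroup F] [NormedSpace ℝ F]
    {a : F → F [⋀^Fin 1]→L[ℝ] ℝ} {x : F} (ha : DifferentiableAt ℝ a x) (v w : F) :
    extDeriv a x ![v, w] = fderiv ℝ (fun y ↦ a y ![w]) x v - fderiv ℝ (fun y ↦ a y ![v]) x w := by
  have h₀ : Fin.removeNth 0 ![v, w] = ![w] := by ext i; fin_cases i; rfl
  have h₁ : Fin.removeNth 1 ![v, w] = ![v] := by ext i; fin_cases i; rfl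
  rw [extDeriv_apply ha, Fin.sum_univ_two, h₀, h₁]
  simp [sub_eq_add_neg]

/-- The Leibniz rule `d(e^θ α) = e^θ (dθ ∧ α + dα)`, computed in the product chart around `q`. -/
theorem symplectizationForm_apply {α : DiffForm I M 1} (hα : α.IsSmooth) (q : M × ℝ)
    (v w : E × ℝ) :
    symplectizationForm α q ![v, w] = Real.exp q.2 *
      (v.2 * α q.1 ![w.1] - w.2 * α q.1 ![v.1] + α.d q.1 ![v.1, w.1]) := by
  set a : E → E [⋀^Fin 1]→L[ℝ] ℝ := α.inChart q.1
  set y : E := extChartAt I q.1 q.1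
  have ha : DifferentiableAt ℝ a y :=
    (hα.contDiffAt q.1 (mem_extChartAt_target q.1)).differentiableAt (by simp)
  have hq : extChartAt (I.prod 𝓘(ℝ, ℝ)) q q = (y, q.2) := by rw [extChartAt_prod]; rfl
  have hev : (expMulForm α).inChart q =ᶠ[𝓝 (y, q.2)] fun z ↦ Real.exp z.2 •
      (a z.1).compContinuousLinearMap (ContinuousLinearMap.fst ℝ E ℝ) := by
    rw [← hq]
    filter_upwards [extChartAt_target_mem_nhds (I := I.prod 𝓘(ℝ, ℝ)) q] with z hz
    exact expMulForm_inChart α q hz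
  have hsm : DifferentiableAt ℝ ((expMulForm α).inChart q) (y, q.2) := by
    rw [← hq]
    exact ((expMulForm_isSmooth hα).contDiffAt q (mem_extChartAt_target q)).differentiableAt
      (by simp)
  have hb : ∀ u : E, DifferentiableAt ℝ (fun z : E ↦ a z ![u]) y := fun u ↦
    ((ContinuousAlternatingMap.apply ℝ E ℝ ![u]).differentiableAt.comp y ha :)
  have hder : ∀ u v : E × ℝ, fderiv ℝ (fun z : E × ℝ ↦ (Real.exp z.2 •
      (a z.1).compContinuousLinearMap (ContinuousLinearMap.fst ℝ E ℝ)) ![u]) (y, q.2) v =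
      Real.exp q.2 * (v.2 * a y ![u.1] + fderiv ℝ (fun z ↦ a z ![u.1]) y v.1) := by
    intro u v
    have hfun : (fun z : E × ℝ ↦ (Real.exp z.2 •
        (a z.1).compContinuousLinearMap (ContinuousLinearMap.fst ℝ E ℝ)) ![u]) =
        fun z : E × ℝ ↦ Real.exp z.2 * a z.1 ![u.1] := by
      ext z
      have : (Prod.fst ∘ ![u]) = ![u.1] := by ext i; fin_cases i; rfl
      simp [this]
    have h1 : HasFDerivAt (fun z : E × ℝ ↦ Real.exp z.2)
        (Real.exp q.2 • ContinuousLinearMap.snd ℝ E ℝ) (y, q.2) :=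
      (hasFDerivAt_snd (𝕜 := ℝ) (p := (y, q.2))).exp
    have h2 : HasFDerivAt (fun z : E × ℝ ↦ a z.1 ![u.1])
        ((fderiv ℝ (fun z ↦ a z ![u.1]) y).comp (ContinuousLinearMap.fst ℝ E ℝ)) (y, q.2) :=
      HasFDerivAt.comp (y, q.2) (g := fun z ↦ a z ![u.1]) (hb u.1).hasFDerivAt hasFDerivAt_fst
    rw [hfun, (h1.fun_mul h2).fderiv]
    simp
    ring
  have hself : ∀ u : E, α q.1 ![u] = a y ![u] := fun u ↦ (α.inChart_apply_self q.1 ![u]).symm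
  rw [symplectizationForm]
  refine ((expMulForm α).d_apply q ![v, w]).trans ?_
  rw [hq, hev.extDeriv_eq, extDeriv_one_form_apply (hev.differentiableAt_iff.1 hsm), hder, hder,
    show α.d q.1 ![v.1, w.1] = extDeriv a y ![v.1, w.1] from α.d_apply q.1 _,
    extDeriv_one_form_apply ha, hself, hself]
  ring

end Symplectization


/-! ### Tangent spaces and slice charts of `Y × ℝ` -/

section Cylinder

variable {E : Type*} [NormedAddCommGroup E] [NormedSpace ℝ E]
  {H : Type*} [TopologicalSpace H] {I : ModelWithCorners ℝ E H}
  {M : Type*} [TopologicalSpace M] [ChartedSpace H M]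

theorem velocity_mem_tangentSpaceOf {Y : Set M} {p : M} {v : TangentSpace I p} {γ : ℝ → M}
    (hγ : ContMDiffAt 𝓘(ℝ, ℝ) I ∞ γ 0) (hγY : ∀ᶠ t in 𝓝 0, γ t ∈ Y)
    (hv : tangentMap 𝓘(ℝ, ℝ) I γ ⟨0, (1 : ℝ)⟩ = ⟨p, v⟩) : v ∈ tangentSpaceOf I Y p :=
  Submodule.subset_span ⟨γ, hγ, hγY, hv⟩

theorem fst_mem_tangentSpaceOf {Y : Set M} {q : M × ℝ} {v : E × ℝ}
    (hv : v ∈ tangentSpaceOf (I.prod 𝓘(ℝ, ℝ)) (Y ×ˢ (Set.univ : Set ℝ)) q) :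
    v.1 ∈ tangentSpaceOf I Y q.1 := by
  suffices h : tangentSpaceOf (I.prod 𝓘(ℝ, ℝ)) (Y ×ˢ (Set.univ : Set ℝ)) q ≤
      (tangentSpaceOf I Y q.1).comap (LinearMap.fst ℝ E ℝ) from h hv
  refine Submodule.span_le.2 ?_
  rintro v ⟨γ, hγ, hγY, hv⟩
  refine Submodule.subset_span ⟨Prod.fst ∘ γ, contMDiffAt_fst.comp _ hγ,
    hγY.mono fun t ht ↦ ht.1, ?_⟩
  rw [tangentMap_comp_at (I' := I.prod 𝓘(ℝ, ℝ)) _ mdifferentiableAt_fst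
    (hγ.mdifferentiableAt (by simp)), hv, tangentMap_prodFst]
  rfl

/-- Split `(v, s) = (v, 0) + s (0, 1)`: curves in `Y` lift to height `t`, and `(0, 1)` is the
velocity of the vertical line through `(p, t)`. -/
theorem mk_mem_tangentSpaceOf {Y : Set M} {p : M} (hp : p ∈ Y) (t : ℝ) {v : E}
    (hv : v ∈ tangentSpaceOf I Y p) (s : ℝ) :
    ((v, s) : E × ℝ) ∈
      tangentSpaceOf (I.prod 𝓘(ℝ, ℝ)) (Y ×ˢ (Set.univ : Set ℝ)) (p, t) := by
  set T : Submodule ℝ (E × ℝ) :=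
    tangentSpaceOf (I.prod 𝓘(ℝ, ℝ)) (Y ×ˢ (Set.univ : Set ℝ)) (p, t)
  have h₁ : ((v, 0) : E × ℝ) ∈ T := by
    suffices h : tangentSpaceOf I Y p ≤ T.comap (LinearMap.inl ℝ E ℝ) from h hv
    refine Submodule.span_le.2 ?_
    rintro v ⟨γ, hγ, hγY, hv⟩
    refine Submodule.subset_span ⟨(fun x ↦ (x, t)) ∘ γ,
      ContMDiffAt.comp (I' := I) _ (contMDiffAt_id.prodMk contMDiffAt_const) hγ,
      hγY.mono fun u hu ↦ ⟨hu, trivial⟩, ?_⟩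
    have hmk : MDifferentiableAt I (I.prod 𝓘(ℝ, ℝ)) (fun x : M ↦ (x, t)) (γ 0) :=
      mdifferentiableAt_id.prodMk mdifferentiableAt_const
    rw [tangentMap_comp_at (I' := I) _ hmk (hγ.mdifferentiableAt (by simp)),
      hv, tangentMap_prod_left]
    rfl
  have h₂ : ((0, 1) : E × ℝ) ∈ T := by
    have hadd : ContMDiffAt 𝓘(ℝ, ℝ) 𝓘(ℝ, ℝ) ∞ (fun u : ℝ ↦ t + u) 0 :=
      (contDiff_const.add contDiff_id).contDiffAt.contMDiffAt
    refine velocity_mem_tangentSpaceOf (I := I.prod 𝓘(ℝ, ℝ)) (p := (p, t)) (v := ((0, 1) : E × ℝ))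
      (γ := (fun x ↦ (p, x)) ∘ (fun u : ℝ ↦ t + u))
      (ContMDiffAt.comp (I' := 𝓘(ℝ, ℝ)) _ (contMDiffAt_const.prodMk contMDiffAt_id) hadd)
      (Filter.Eventually.of_forall fun u ↦ ⟨hp, trivial⟩) ?_
    have htan : tangentMap 𝓘(ℝ, ℝ) 𝓘(ℝ, ℝ) (fun u : ℝ ↦ t + u) ⟨0, (1 : ℝ)⟩ = ⟨t, (1 : ℝ)⟩ := by
      refine Bundle.TotalSpace.ext (add_zero t) (heq_of_eq ?_)
      simp only [tangentMap, mfderiv_eq_fderiv]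
      rw [fderiv_const_add, fderiv_fun_id]
      rfl
    have hmk : MDifferentiableAt 𝓘(ℝ, ℝ) (I.prod 𝓘(ℝ, ℝ)) (fun x : ℝ ↦ (p, x)) (t + 0) :=
      mdifferentiableAt_const.prodMk mdifferentiableAt_id
    rw [tangentMap_comp_at (I' := 𝓘(ℝ, ℝ)) _ hmk (hadd.mdifferentiableAt (by simp)),
      htan, tangentMap_prod_right]
  have h : ((v, 0) : E × ℝ) + s • ((0, 1) : E × ℝ) ∈ T := T.add_mem h₁ (T.smul_mem s h₂)
  have hvs : ((v, 0) : E × ℝ) + s • ((0, 1) : E × ℝ) = (v, s) := by simp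
  rw [hvs] at h
  exact h

/-- The tangent spaces of the cylinder `Y × ℝ` are those of `Y` times `ℝ`. -/
theorem mem_tangentSpaceOf_cylinder {Y : Set M} {q : M × ℝ} (hq : q.1 ∈ Y) {v : E × ℝ} :
    v ∈ tangentSpaceOf (I.prod 𝓘(ℝ, ℝ)) (Y ×ˢ (Set.univ : Set ℝ)) q ↔
      v.1 ∈ tangentSpaceOf I Y q.1 :=
  ⟨fst_mem_tangentSpaceOf, fun h ↦ mk_mem_tangentSpaceOf hq q.2 h v.2⟩

/-- The product of a slice chart with the identity of `ℝ` is a slice chart, with model subspace `V ×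
ℝ`. -/
theorem IsSubmanifold.cylinder [FiniteDimensional ℝ E] [IsManifold I ∞ M] {Y : Set M}
    (hY : IsSubmanifold I Y) :
    IsSubmanifold (I.prod 𝓘(ℝ, ℝ)) (Y ×ˢ (Set.univ : Set ℝ)) := by
  obtain ⟨k, hk⟩ := hY
  refine ⟨k + 1, fun q hq ↦ ?_⟩
  obtain ⟨e, he, hpe, V, hV, heV⟩ := hk q.1 hq.1
  refine ⟨e.prod (OpenPartialHomeomorph.refl ℝ), IsManifold.mem_maximalAtlas_prod he
    (StructureGroupoid.id_mem_maximalAtlas _), ⟨hpe, trivial⟩, V.prod ⊤, ?_, fun r hr ↦ ?_⟩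
  · have h := LinearMap.finrank_range_of_inj (f := V.subtype.prodMap (LinearMap.id (M := ℝ)))
      (V.injective_subtype.prodMap Function.injective_id)
    rw [LinearMap.range_prodMap, Submodule.range_subtype, LinearMap.range_id] at h
    rw [h, Module.finrank_prod, hV, Module.finrank_self]
  · simpa using heV r.1 hr.1

end Cylinder

/-! ### Linear functionals on a subspace -/

section LinearAlgebra

variable {F : Type*} [NormedAddCommGroup F] [NormedSpace ℝ F]

theorem exists_linearMap_one_form (f : F [⋀^Fin 1]→L[ℝ] ℝ) :
    ∃ A : F →ₗ[ℝ] ℝ, ∀ v, A v = f ![v] := by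
  refine ⟨((ContinuousAlternatingMap.ofSubsingleton ℝ F ℝ (0 : Fin 1)).symm f : F →L[ℝ] ℝ),
    fun v ↦ ?_⟩
  obtain ⟨g, rfl⟩ := (ContinuousAlternatingMap.ofSubsingleton ℝ F ℝ (0 : Fin 1)).surjective f
  simp

theorem exists_linearMap_two_form (f : F [⋀^Fin 2]→L[ℝ] ℝ) (v : F) :
    ∃ B : F →ₗ[ℝ] ℝ, ∀ w, B w = f ![v, w] := by
  refine ⟨f.toMultilinearMap.toLinearMap ![v, 0] 1, fun w ↦ ?_⟩
  have : Function.update ![v, 0] 1 w = ![v, w] := by ext i; fin_cases i <;> rfl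
  simp [this]

theorem exists_eq_mul_of_ker_le {A B : F →ₗ[ℝ] ℝ} {S : Submodule ℝ F}
    (h : ∀ w ∈ S, A w = 0 → B w = 0) : ∃ c : ℝ, ∀ w ∈ S, B w = c * A w := by
  by_cases hA : ∀ w ∈ S, A w = 0
  · exact ⟨0, fun w hw ↦ by rw [h w hw (hA w hw), zero_mul]⟩
  push Not at hA
  obtain ⟨w₀, hw₀, hne⟩ := hA
  refine ⟨B w₀ / A w₀, fun w hw ↦ ?_⟩
  -- The projection of `w` along `w₀` into the kernel of `A`.
  have := h (w - (A w / A w₀) • w₀) (S.sub_mem hw (S.smul_mem _ hw₀)) (by simp [hne])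
  simp only [map_sub, map_smul, smul_eq_mul] at this
  field_simp at this ⊢
  linarith

end LinearAlgebra

/-! ### Orthogonal complements and the correspondence -/

section Correspondence

variable {E : Type*} [NormedAddCommGroup E] [NormedSpace ℝ E]
  {H : Type*} [TopologicalSpace H] {I : ModelWithCorners ℝ E H} [I.Boundaryless]
  {M : Type*} [TopologicalSpace M] [ChartedSpace H M] [IsManifold I ∞ M]
  {α : DiffForm I M 1}

/-- A vector orthogonal to `T × ℝ` for `d(e^θ α)` has its `M`-component in `ker α`, and orthogonal
to `T ∩ ker α` for `dα`. -/
theorem orthogonal_of_symplectizationForm (hα : α.IsSmooth) {q : M × ℝ}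
    {T : Submodule ℝ (TangentSpace I q.1)} {v : E × ℝ}
    (hv : ∀ w : E × ℝ, w.1 ∈ T → symplectizationForm α q ![v, w] = 0) :
    v.1 ∈ ker α q.1 ∧ ∀ w ∈ T, α.d q.1 ![v.1, w] = - (v.2 * α q.1 ![w]) := by
  have hv' : ∀ w : E, w ∈ T → ∀ s : ℝ,
      v.2 * α q.1 ![w] - s * α q.1 ![v.1] + α.d q.1 ![v.1, w] = 0 := fun w hw s ↦ by
    have := hv (w, s) hw
    rw [symplectizationForm_apply hα] at this
    exact (mul_eq_zero.1 this).resolve_left (Real.exp_ne_zero _)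
  refine ⟨?_, fun w hw ↦ ?_⟩
  · have h₀ := hv' 0 T.zero_mem 0
    have h₁ := hv' 0 T.zero_mem 1
    change α q.1 ![v.1] = 0
    linarith
  · have := hv' w hw 0
    linarith

theorem symplectizationForm_isSymplecticForm (hα : IsContactForm α) :
    IsSymplecticForm (symplectizationForm α) where
  smooth := (expMulForm_isSmooth hα.smooth).d
  closed := (expMulForm_isSmooth hα.smooth).d_d
  nondegenerate := by
    intro q (v : E × ℝ) hv
    obtain ⟨hker, hd⟩ := orthogonal_of_symplectizationForm (T := ⊤) hα.smooth
      (v := v) fun w _ ↦ hv w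
    have hv₁ : v.1 = 0 := hα.nondegenerate q.1 v.1 hker fun w hw ↦ by
      rw [hd w trivial, show α q.1 ![w] = 0 from hw, mul_zero, neg_zero]
    -- With `v₁ = 0`, what remains is `v₂ α = 0`, so a vector off `ξ` forces `v₂ = 0`.
    obtain ⟨w, hw⟩ : ∃ w : E, α q.1 ![w] ≠ 0 := by
      by_contra! h
      refine hα.ne_zero q.1 (ContinuousAlternatingMap.ext fun u ↦ ?_)
      have : u = ![u 0] := by ext i; fin_cases i; rfl
      rw [this]
      exact h (u 0)
    have h := hd w trivial
    rw [(α.d q.1).map_coord_zero (m := ![v.1, w]) 0 hv₁] at h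
    have hv₂ : v.2 = 0 := (mul_eq_zero.1 (neg_eq_zero.1 h.symm)).resolve_right hw
    exact Prod.ext hv₁ hv₂

theorem IsContactCoisotropic.cylinder [FiniteDimensional ℝ E] (hα : IsContactForm α) {Y : Set M}
    (hY : IsContactCoisotropic α Y) :
    IsSymplecticCoisotropic (symplectizationForm α) (Y ×ˢ (Set.univ : Set ℝ)) := by
  refine ⟨hY.1.cylinder, fun q hq (v : E × ℝ) hv ↦ ?_⟩
  obtain ⟨hker, hd⟩ := orthogonal_of_symplectizationForm (T := tangentSpaceOf I Y q.1) hα.smooth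
    (v := v) fun w hw ↦ hv w ((mem_tangentSpaceOf_cylinder hq.1).2 hw)
  refine (mem_tangentSpaceOf_cylinder hq.1).2 (hY.2 q.1 hq.1 v.1 hker fun w hw ↦ ?_).1
  rw [hd w hw.1, show α q.1 ![w] = 0 from hw.2, mul_zero, neg_zero]

theorem IsSymplecticCoisotropic.of_cylinder (hα : IsContactForm α) {Y : Set M}
    (hY : IsSubmanifold I Y)
    (hYR : IsSymplecticCoisotropic (symplectizationForm α) (Y ×ˢ (Set.univ : Set ℝ))) :
    IsContactCoisotropic α Y := by
  refine ⟨hY, fun p hp v hv hvY ↦ ⟨?_, hv⟩⟩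
  obtain ⟨A, hA⟩ := exists_linearMap_one_form (F := E) (α p)
  obtain ⟨B, hB⟩ := exists_linearMap_two_form (F := E) (α.d p) v
  have hAB : ∀ w : E, w ∈ tangentSpaceOf I Y p → A w = 0 → B w = 0 := by
    intro w hw hAw
    rw [hA] at hAw
    rw [hB]
    exact hvY w ⟨hw, hAw⟩
  obtain ⟨c, hc⟩ := exists_eq_mul_of_ker_le (F := E) (S := tangentSpaceOf I Y p) hAB
  -- The component `-c` cancels `dα(v, ·) = c α` on `TY`; the height `0` is an arbitrary choice.
  have hmem : ((v, -c) : E × ℝ) ∈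
      tangentSpaceOf (I.prod 𝓘(ℝ, ℝ)) (Y ×ˢ (Set.univ : Set ℝ)) (p, 0) := by
    refine hYR.2 (p, 0) ⟨hp, trivial⟩ (v, -c) fun (w : E × ℝ) hw ↦ ?_
    have hcw := hc w.1 (fst_mem_tangentSpaceOf (q := (p, 0)) hw)
    rw [hA, hB] at hcw
    refine (symplectizationForm_apply hα.smooth (p, 0) (v, -c) w).trans ?_
    have hv0 : α p ![v] = 0 := hv
    have harith : ∀ r a b d s : ℝ, d = c * a → b = 0 → r * (-c * a - s * b + d) = 0 := by
      rintro r a b d s rfl rfl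
      ring
    exact harith _ _ _ _ _ hcw hv0
  exact fst_mem_tangentSpaceOf (q := (p, 0)) hmem

end Correspondence

end CoisotropicCorrespondence

open CoisotropicCorrespondence in
theorem mainTheorem6
    {E : Type*} [NormedAddCommGroup E] [NormedSpace ℝ E] [FiniteDimensional ℝ E]
    {H : Type*} [TopologicalSpace H] (I : ModelWithCorners ℝ E H) [I.Boundaryless]
    {M : Type*} [TopologicalSpace M] [ChartedSpace H M] [IsManifold I ∞ M]
    (α : DiffForm I M 1) (hα : IsContactForm α) (Y : Set M) :
    IsSymplecticForm (symplectizationForm α) ∧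
    (IsContactCoisotropic α Y →
      IsSymplecticCoisotropic (symplectizationForm α) (Y ×ˢ (Set.univ : Set ℝ))) ∧
    (IsSubmanifold I Y →
      IsSymplecticCoisotropic (symplectizationForm α) (Y ×ˢ (Set.univ : Set ℝ)) →
        IsContactCoisotropic α Y) :=
  ⟨symplectizationForm_isSymplecticForm hα, fun hY ↦ hY.cylinder hα,
    IsSymplecticCoisotropic.of_cylinder hα⟩
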